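/- Let $\omega = e^{2\pi i/3}$, and let $$\theta(q) = \prod_{k=1}^{\infty} (1-q^k), \qquad G(q) = \sum_{b,c\in\mathbb{Z}} \omega^{b-c}\, q^{b^2+bc+c^2},$$ regarded as formal power series in $q$ with complex coefficients. Then the product and the double sum (taken over $\mathbb{Z}^2$ in any order) converge coefficientwise, the power series $\theta(q^3)$ is invertible in $\mathbb{C}[[q]]$, and $$\frac{\theta(q)^3}{\theta(q^3)} = G(q) \quad\text{in } \mathbb{C}[[q]].$$ -/

import Mathlib

open scoped PowerSeries PowerSeries.WithPiTopology

/-- The primitive cube root of unity `ω = e^{2πi/3}`. -/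
noncomputable def cubeOmega : ℂ := Complex.exp (2 * Real.pi * Complex.I / 3)

/-- The `k`-th factor (counted from `k = 0`) `1 - q^(k+1)` of the Euler product. -/
noncomputable def eulerFactor (k : ℕ) : ℂ⟦X⟧ := 1 - PowerSeries.X ^ (k + 1)

/-- `θ(q) = ∏_{k ≥ 1} (1 - q^k)`, as a formal power series in `q` over `ℂ`. -/
noncomputable def thetaSeries : ℂ⟦X⟧ := ∏' k : ℕ, eulerFactor k

/-- `θ(q³)`: the power series obtained from `θ(q)` by substituting `q³` for `q`. -/
noncomputable def thetaSeriesCubed : ℂ⟦X⟧ :=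
  PowerSeries.expand 3 (by norm_num) thetaSeries

/-- The binary quadratic form `b² + bc + c²`. -/
def formQ (b c : ℤ) : ℤ := b ^ 2 + b * c + c ^ 2

/-- The form takes only nonnegative values, so `Int.toNat` below loses nothing. -/
theorem formQ_toNat (b c : ℤ) : ((formQ b c).toNat : ℤ) = formQ b c := by
  apply Int.toNat_of_nonneg
  unfold formQ
  nlinarith [sq_nonneg (b + c), sq_nonneg b, sq_nonneg c]

/-- The term `ω^(b-c) q^(b²+bc+c²)` (an integer power of `ω`). -/
noncomputable def cubicTerm (p : ℤ × ℤ) : ℂ⟦X⟧ :=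
  PowerSeries.C (cubeOmega ^ (p.1 - p.2)) * PowerSeries.X ^ (formQ p.1 p.2).toNat

/-- `G(q) = ∑_{b,c ∈ ℤ} ω^(b-c) q^(b²+bc+c²)`. -/
noncomputable def cubicSeries : ℂ⟦X⟧ := ∑' p : ℤ × ℤ, cubicTerm p

/-! The identity is the limit of a finite one. Since `(1 - z)(1 - ωz)(1 - ω²z) = 1 - z³`, the
product of the three twists of `∏_{i<2n} (1 - z q^i)` is `∏_{i<2n} (1 - z³ q^{3i})`. Expanding all
four products by the `q`-binomial theorem and comparing coefficients of `z^{3n}` writes the central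
Gaussian binomial at `q³` as a sum of terms of `G`, each weighted by three Gaussian binomials at `q`
(`gaussBinom_X_pow_three`). Modulo `q^N`, for large `n`, the left side is `1/θ(q³)` and each weight
that matters is `1/θ(q)³`, so `1/θ(q³) = G(q)/θ(q)³`. -/

/-- The `q`-factorial without denominators `∏_{k=1}^{n} (1 - q^k)`. -/
def qPochhammer {R : Type*} [CommRing R] (q : R) (n : ℕ) : R :=
  ∏ k ∈ Finset.range n, (1 - q ^ (k + 1))

theorem qPochhammer_zero {R : Type*} [CommRing R] (q : R) : qPochhammer q 0 = 1 := by
  simp [qPochhammer]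

theorem qPochhammer_succ {R : Type*} [CommRing R] (q : R) (n : ℕ) :
    qPochhammer q (n + 1) = qPochhammer q n * (1 - q ^ (n + 1)) := by
  simp [qPochhammer, Finset.prod_range_succ]

/-- The Gaussian binomial coefficient at `q`. -/
def gaussBinom {R : Type*} [CommRing R] (q : R) : ℕ → ℕ → R
  | _, 0 => 1
  | 0, _ + 1 => 0
  | n + 1, k + 1 => gaussBinom q n k + q ^ (k + 1) * gaussBinom q n (k + 1)

/-! ### Gaussian binomials and the `q`-binomial theorem -/

section GaussBinom

variable {R : Type*} [CommRing R] (q : R)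

theorem gaussBinom_zero_right (n : ℕ) : gaussBinom q n 0 = 1 := by
  cases n <;> rfl

theorem gaussBinom_zero_succ (k : ℕ) : gaussBinom q 0 (k + 1) = 0 := rfl

theorem gaussBinom_succ_succ (n k : ℕ) :
    gaussBinom q (n + 1) (k + 1) = gaussBinom q n k + q ^ (k + 1) * gaussBinom q n (k + 1) := rfl

theorem gaussBinom_eq_zero_of_lt {n k : ℕ} (h : n < k) : gaussBinom q n k = 0 := by
  induction n generalizing k with
  | zero => obtain ⟨k, rfl⟩ := Nat.exists_eq_succ_of_ne_zero h.ne'; rfl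
  | succ n ih =>
    obtain ⟨k, rfl⟩ := Nat.exists_eq_succ_of_ne_zero (Nat.ne_zero_of_lt h)
    rw [Nat.succ_eq_add_one, gaussBinom_succ_succ, ih (by omega), ih (by omega)]
    simp

theorem gaussBinom_self (n : ℕ) : gaussBinom q n n = 1 := by
  induction n with
  | zero => rfl
  | succ n ih => rw [gaussBinom_succ_succ, ih, gaussBinom_eq_zero_of_lt q n.lt_succ_self]; simp

/-- The factorial formula, kept free of division so that it holds over any commutative ring. -/
theorem gaussBinom_add_mul_qPochhammer (a b : ℕ) :
    gaussBinom q (a + b) a * qPochhammer q a * qPochhammer q b = qPochhammer q (a + b) := by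
  induction h : a + b generalizing a b with
  | zero =>
    obtain ⟨rfl, rfl⟩ : a = 0 ∧ b = 0 := by omega
    simp [gaussBinom_zero_right, qPochhammer_zero]
  | succ n ih =>
    rcases a with _ | a
    · simp only [Nat.zero_add] at h
      simp [gaussBinom_zero_right, qPochhammer_zero, h]
    rcases b with _ | b
    · simp only [Nat.add_zero] at h
      simp [h, gaussBinom_self, qPochhammer_zero]
    have h1 := ih a (b + 1) (by omega)
    have h2 := ih (a + 1) b (by omega)
    rw [gaussBinom_succ_succ, qPochhammer_succ q n, ← show a + 1 + b = n by omega]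
    rw [← show a + 1 + b = n by omega] at h1 h2
    rw [qPochhammer_succ] at h1 h2 ⊢
    rw [qPochhammer_succ q b]
    linear_combination (1 - q ^ (a + 1)) * h1 + q ^ (a + 1) * (1 - q ^ (b + 1)) * h2

theorem map_gaussBinom {S : Type*} [CommRing S] (f : R →+* S) (n k : ℕ) :
    f (gaussBinom q n k) = gaussBinom (f q) n k := by
  induction n generalizing k with
  | zero => cases k <;> simp [gaussBinom_zero_right, gaussBinom_zero_succ]
  | succ n ih => cases k <;> simp [gaussBinom_zero_right, gaussBinom_succ_succ, ih]

/-- The `q`-binomial theorem. -/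
theorem prod_one_sub_mul_pow (z : R) (m : ℕ) :
    ∏ i ∈ Finset.range m, (1 - z * q ^ i) =
      ∑ k ∈ Finset.range (m + 1), (-1) ^ k * q ^ k.choose 2 * gaussBinom q m k * z ^ k := by
  induction m generalizing z with
  | zero => simp [gaussBinom_zero_right]
  | succ m ih =>
    -- Splitting off the factor `i = 0` leaves the product at `z * q`, which matches the `q ^ (k +
    -- 1)` in the Pascal recursion.
    have h : ∏ i ∈ Finset.range (m + 1), (1 - z * q ^ i) =
        (∏ i ∈ Finset.range m, (1 - z * q * q ^ i)) * (1 - z) := by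
      rw [Finset.prod_range_succ']
      simp [pow_succ', mul_assoc]
    -- The extra term `k = m + 1` vanishes; adding it lets the sum be shifted by one.
    have h0 := Finset.sum_range_succ'
      (fun k ↦ (-1) ^ k * q ^ k.choose 2 * gaussBinom q m k * (z * q) ^ k) (m + 1)
    rw [Finset.sum_range_succ] at h0
    simp only [gaussBinom_eq_zero_of_lt q m.lt_succ_self, mul_zero, zero_mul, add_zero] at h0
    rw [h, ih, mul_sub, mul_one, Finset.sum_range_succ' _ (m + 1)]
    nth_rw 1 [h0]
    rw [Finset.sum_mul, add_sub_right_comm, ← Finset.sum_sub_distrib]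
    congr 1
    · refine Finset.sum_congr rfl fun k _ ↦ ?_
      rw [gaussBinom_succ_succ, Nat.choose_succ_succ' k 1, Nat.choose_one_right]
      ring
    · simp [gaussBinom_zero_right]

end GaussBinom

/-! ### The finite identity -/

/-- As `i + j + k = 3n`, the linear terms cancel and `i² + j² + k² = 3n² + 2(b² + bc + c²)`. -/
theorem formQ_add_choose {n i j k : ℕ} {b c : ℤ} (hi : (i : ℤ) = n - b - c) (hj : (j : ℤ) = n + b)
    (hk : (k : ℤ) = n + c) :
    i.choose 2 + j.choose 2 + k.choose 2 = (formQ b c).toNat + 3 * n.choose 2 := by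
  have h := formQ_toNat b c
  have hi' : (i : ℚ) = n - b - c := by exact_mod_cast hi
  have hj' : (j : ℚ) = n + b := by exact_mod_cast hj
  have hk' : (k : ℚ) = n + c := by exact_mod_cast hk
  have h' : ((formQ b c).toNat : ℚ) = b ^ 2 + b * c + c ^ 2 := by
    rw [formQ] at h ⊢
    exact_mod_cast h
  have : ((i.choose 2 + j.choose 2 + k.choose 2 : ℕ) : ℚ) =
      ((formQ b c).toNat + 3 * n.choose 2 : ℕ) := by
    push_cast
    rw [h', Nat.cast_choose_two, Nat.cast_choose_two, Nat.cast_choose_two, Nat.cast_choose_two,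
      hi', hj', hk']
    ring
  exact_mod_cast this

/-- The lattice points `(b, c)` with `|b|, |c|, |b + c| ≤ n`. -/
noncomputable def hexagon (n : ℕ) : Finset (ℤ × ℤ) :=
  (Finset.Icc (-n : ℤ) n ×ˢ Finset.Icc (-n : ℤ) n).filter
    fun p ↦ -(n : ℤ) ≤ p.1 + p.2 ∧ p.1 + p.2 ≤ n

theorem mem_hexagon {n : ℕ} {p : ℤ × ℤ} :
    p ∈ hexagon n ↔ (-n ≤ p.1 ∧ p.1 ≤ n) ∧ (-n ≤ p.2 ∧ p.2 ≤ n) ∧ -n ≤ p.1 + p.2 ∧ p.1 + p.2 ≤ n := by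
  simp [hexagon, and_assoc]

theorem cubeOmega_pow_three : cubeOmega ^ 3 = 1 := by
  rw [cubeOmega, ← Complex.exp_nat_mul, ← Complex.exp_two_pi_mul_I]
  congr 1
  push_cast
  ring

theorem cubeOmega_ne_zero : cubeOmega ≠ 0 := Complex.exp_ne_zero _

theorem cubeOmega_sum : 1 + cubeOmega + cubeOmega ^ 2 = 0 := by
  have h : IsPrimitiveRoot cubeOmega 3 := by
    have := Complex.isPrimitiveRoot_exp 3 (by norm_num)
    simpa [cubeOmega] using this
  have := h.geom_sum_eq_zero (by norm_num)
  simpa [Finset.sum_range_succ] using this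

theorem one_sub_mul_one_sub_mul_one_sub {R : Type*} [CommRing R] {w : R} (h : 1 + w + w ^ 2 = 0)
    (z : R) : (1 - z) * (1 - w * z) * (1 - w ^ 2 * z) = 1 - z ^ 3 := by
  linear_combination (-z + z ^ 2 * w - z ^ 3 * (w - 1)) * h

-- The polynomial variable plays the role of `z`, over coefficients in `ℂ⟦q⟧`.
open Polynomial in
theorem coeff_prod_three_twists (n : ℕ) :
    (-1) ^ n * (PowerSeries.X ^ 3 : ℂ⟦X⟧) ^ n.choose 2 * gaussBinom (PowerSeries.X ^ 3) (2 * n) n =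
      ∑ t ∈ (Finset.range (2 * n + 1) ×ˢ Finset.range (2 * n + 1) ×ˢ Finset.range (2 * n + 1)).filter
          (fun t ↦ t.1 + t.2.1 + t.2.2 = 3 * n),
        (-1) ^ (3 * n) * PowerSeries.C (cubeOmega ^ (t.2.1 + 2 * t.2.2)) *
          (PowerSeries.X ^ (t.1.choose 2 + t.2.1.choose 2 + t.2.2.choose 2) *
          (gaussBinom PowerSeries.X (2 * n) t.1 * gaussBinom PowerSeries.X (2 * n) t.2.1 *
            gaussBinom PowerSeries.X (2 * n) t.2.2)) := by
  set q : ℂ⟦X⟧ := PowerSeries.X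
  set w : ℂ⟦X⟧ := PowerSeries.C cubeOmega with hw
  have hsum : 1 + w + w ^ 2 = 0 := by
    rw [hw, ← map_pow, ← map_one (PowerSeries.C (R := ℂ)), ← map_add, ← map_add, cubeOmega_sum,
      map_zero]
  have hsum' : (1 : ℂ⟦X⟧[X]) + C w + C w ^ 2 = 0 := by
    rw [← map_pow, ← map_one C, ← map_add, ← map_add, hsum, map_zero]
  have key : (∏ i ∈ Finset.range (2 * n), (1 - (X : ℂ⟦X⟧[X]) * C q ^ i)) *
      ((∏ i ∈ Finset.range (2 * n), (1 - (C w * X) * C q ^ i)) *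
      (∏ i ∈ Finset.range (2 * n), (1 - (C w ^ 2 * X) * C q ^ i))) =
      ∏ i ∈ Finset.range (2 * n), (1 - X ^ 3 * C (q ^ 3) ^ i) := by
    rw [← Finset.prod_mul_distrib, ← Finset.prod_mul_distrib]
    refine Finset.prod_congr rfl fun i _ ↦ ?_
    have := one_sub_mul_one_sub_mul_one_sub hsum' (X * C q ^ i)
    rw [map_pow]
    linear_combination this
  simp only [prod_one_sub_mul_pow] at key
  have key := congrArg (fun p ↦ p.coeff (3 * n)) key
  have hR : (∑ k ∈ Finset.range (2 * n + 1), (-1) ^ k * C (q ^ 3) ^ k.choose 2 *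
      gaussBinom (C (q ^ 3)) (2 * n) k * (X ^ 3) ^ k).coeff (3 * n) =
      (-1) ^ n * (q ^ 3) ^ n.choose 2 * gaussBinom (q ^ 3) (2 * n) n := by
    have (k : ℕ) : (-1) ^ k * C (q ^ 3) ^ k.choose 2 *
      gaussBinom (C (q ^ 3)) (2 * n) k * (X ^ 3) ^ k =
      C ((-1) ^ k * (q ^ 3) ^ k.choose 2 * gaussBinom (q ^ 3) (2 * n) k) * X ^ (3 * k) := by
      simp [map_gaussBinom, pow_mul]
    simp only [this, finsetSum_coeff, coeff_C_mul, coeff_X_pow]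
    rw [Finset.sum_eq_single n]
    · simp
    · intro b _ hb
      rw [if_neg (by omega), mul_zero]
    · intro h
      simp at h
      omega
  rw [hR] at key
  rw [← key, Finset.sum_mul_sum, ← Finset.sum_product', Finset.sum_mul_sum, ← Finset.sum_product',
    Finset.sum_filter, finsetSum_coeff]
  refine Finset.sum_congr rfl fun ⟨i, j, k⟩ _ ↦ ?_
  have : (-1) ^ i * C q ^ i.choose 2 * gaussBinom (C q) (2 * n) i * X ^ i *
      ((-1) ^ j * C q ^ j.choose 2 * gaussBinom (C q) (2 * n) j * (C w * X) ^ j *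
      ((-1) ^ k * C q ^ k.choose 2 * gaussBinom (C q) (2 * n) k * (C w ^ 2 * X) ^ k)) =
      C ((-1) ^ (i + j + k) * w ^ (j + 2 * k) * (q ^ (i.choose 2 + j.choose 2 + k.choose 2) *
        (gaussBinom q (2 * n) i * gaussBinom q (2 * n) j * gaussBinom q (2 * n) k))) *
      X ^ (i + j + k) := by
    simp only [map_mul, map_pow, map_gaussBinom, map_neg, map_one]
    ring
  rw [this, coeff_C_mul, coeff_X_pow, map_pow]
  by_cases h : i + j + k = 3 * n
  · simp [h, hw]
  · simp [h, Ne.symm h]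

theorem gaussBinom_X_pow_three (n : ℕ) :
    gaussBinom (PowerSeries.X ^ 3 : ℂ⟦X⟧) (2 * n) n =
      ∑ p ∈ hexagon n, cubicTerm p * (gaussBinom PowerSeries.X (2 * n) (n - p.1 - p.2).toNat *
        gaussBinom PowerSeries.X (2 * n) (n + p.1).toNat *
        gaussBinom PowerSeries.X (2 * n) (n + p.2).toNat) := by
  have h0 : (-1) ^ n * (PowerSeries.X ^ 3 : ℂ⟦X⟧) ^ n.choose 2 ≠ 0 :=
    mul_ne_zero (pow_ne_zero _ (by simp))
      (pow_ne_zero _ (pow_ne_zero _ PowerSeries.X_ne_zero))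
  refine mul_left_cancel₀ h0 ?_
  rw [coeff_prod_three_twists, Finset.mul_sum]
  refine Finset.sum_bij' (fun t _ ↦ ((t.2.1 : ℤ) - n, (t.2.2 : ℤ) - n))
    (fun p _ ↦ ((n - p.1 - p.2).toNat, (n + p.1).toNat, (n + p.2).toNat)) ?_ ?_ ?_ ?_ ?_
  · rintro ⟨i, j, k⟩ h
    simp only [Finset.mem_filter, Finset.mem_product, Finset.mem_range] at h
    rw [mem_hexagon]
    dsimp only
    omega
  · rintro ⟨b, c⟩ h
    rw [mem_hexagon] at h
    simp only [Finset.mem_filter, Finset.mem_product, Finset.mem_range]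
    dsimp only at h
    omega
  · rintro ⟨i, j, k⟩ h
    simp only [Finset.mem_filter, Finset.mem_product, Finset.mem_range] at h
    simp only [Prod.mk.injEq]
    omega
  · rintro ⟨b, c⟩ h
    rw [mem_hexagon] at h
    simp only [Prod.mk.injEq]
    dsimp only at h
    omega
  · rintro ⟨i, j, k⟩ h
    simp only [Finset.mem_filter, Finset.mem_product, Finset.mem_range] at h
    have hQ := formQ_add_choose (n := n) (i := i) (j := j) (k := k) (b := j - n) (c := k - n)
      (by omega) (by omega) (by omega)
    have e1 : ((n : ℤ) - (j - n) - (k - n)).toNat = i := by omega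
    have e2 : ((n : ℤ) + (j - n)).toNat = j := by omega
    have e3 : ((n : ℤ) + (k - n)).toNat = k := by omega
    -- The two exponents differ by `3k`.
    have e4 : cubeOmega ^ (j + 2 * k) = cubeOmega ^ ((j : ℤ) - n - (k - n)) := by
      have : (j : ℤ) - n - (k - n) = ((j + 2 * k : ℕ) : ℤ) + ((3 : ℕ) : ℤ) * (-k) := by
        push_cast; ring
      rw [this, zpow_add₀ cubeOmega_ne_zero, zpow_mul, zpow_natCast, zpow_natCast,
        cubeOmega_pow_three]
      simp
    have e5 : (-1 : ℂ⟦X⟧) ^ (3 * n) = (-1) ^ n := by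
      rw [pow_mul]; norm_num
    dsimp only [cubicTerm]
    rw [e1, e2, e3, e4, e5, hQ]
    ring

/-! ### Convergence and truncation -/

theorem multipliable_eulerFactor : Multipliable eulerFactor :=
  PowerSeries.WithPiTopology.multipliable_one_sub_X_pow ℂ

theorem coeff_qPochhammer_X {d m : ℕ} (h : d ≤ m) :
    PowerSeries.coeff d (qPochhammer (PowerSeries.X : ℂ⟦X⟧) m) =
      PowerSeries.coeff d (qPochhammer (PowerSeries.X : ℂ⟦X⟧) d) := by
  induction m, h using Nat.le_induction with
  | base => rfl
  | succ m h ih =>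
    rw [qPochhammer_succ, mul_sub, mul_one, map_sub, ih, PowerSeries.coeff_mul_X_pow',
      if_neg (by omega), sub_zero]

theorem coeff_thetaSeries {d m : ℕ} (h : d ≤ m) :
    PowerSeries.coeff d thetaSeries =
      PowerSeries.coeff d (qPochhammer (PowerSeries.X : ℂ⟦X⟧) m) := by
  have h1 := multipliable_eulerFactor.hasProd.tendsto_prod_nat
  have h2 := ((PowerSeries.WithPiTopology.continuous_coeff ℂ d).tendsto _).comp h1
  refine tendsto_nhds_unique h2 (tendsto_atTop_of_eventually_const (i₀ := m) fun i hi ↦ ?_)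
  exact (coeff_qPochhammer_X (h.trans hi)).trans (coeff_qPochhammer_X h).symm

theorem X_pow_dvd_thetaSeries_sub (m : ℕ) :
    PowerSeries.X ^ (m + 1) ∣ thetaSeries - qPochhammer (PowerSeries.X : ℂ⟦X⟧) m := by
  rw [PowerSeries.X_pow_dvd_iff]
  intro d hd
  rw [map_sub, coeff_thetaSeries (Nat.lt_succ_iff.mp hd), sub_self]

theorem X_pow_dvd_thetaSeriesCubed_sub (m : ℕ) :
    PowerSeries.X ^ (m + 1) ∣ thetaSeriesCubed - qPochhammer (PowerSeries.X ^ 3 : ℂ⟦X⟧) m := by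
  have h := map_dvd (PowerSeries.expand 3 (by norm_num) : ℂ⟦X⟧ →ₐ[ℂ] ℂ⟦X⟧)
    (X_pow_dvd_thetaSeries_sub m)
  rw [map_pow, PowerSeries.expand_X, map_sub] at h
  have h2 : PowerSeries.expand 3 (by norm_num) (qPochhammer (PowerSeries.X : ℂ⟦X⟧) m) =
      qPochhammer (PowerSeries.X ^ 3) m := by
    simp [qPochhammer]
  rw [h2, ← pow_mul] at h
  exact (pow_dvd_pow _ (by omega)).trans h

theorem constantCoeff_thetaSeries : PowerSeries.constantCoeff thetaSeries = 1 := by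
  rw [← PowerSeries.coeff_zero_eq_constantCoeff_apply, coeff_thetaSeries le_rfl, qPochhammer_zero]
  simp

theorem constantCoeff_thetaSeriesCubed : PowerSeries.constantCoeff thetaSeriesCubed = 1 := by
  rw [thetaSeriesCubed, PowerSeries.constantCoeff_expand, constantCoeff_thetaSeries]

theorem isUnit_thetaSeries : IsUnit thetaSeries := by
  rw [PowerSeries.isUnit_iff_constantCoeff, constantCoeff_thetaSeries]
  exact isUnit_one

theorem isUnit_thetaSeriesCubed : IsUnit thetaSeriesCubed := by
  rw [PowerSeries.isUnit_iff_constantCoeff, constantCoeff_thetaSeriesCubed]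
  exact isUnit_one

theorem mem_hexagon_of_formQ_le {n : ℕ} {p : ℤ × ℤ} (h : formQ p.1 p.2 ≤ n) : p ∈ hexagon n := by
  obtain ⟨b, c⟩ := p
  -- If `|x| ≥ n + 1`, then `4 * formQ b c ≥ 3(n + 1)² > 4n`.
  have aux (x y : ℤ) (hxy : 3 * x ^ 2 + y ^ 2 = 4 * formQ b c) : -n ≤ x ∧ x ≤ n := by
    refine abs_le.mp (not_lt.mp fun hx ↦ ?_)
    have h1 : (n + 1 : ℤ) ≤ |x| := hx
    have h2 := sq_abs x
    dsimp only at h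
    nlinarith [sq_nonneg y]
  rw [mem_hexagon]
  exact ⟨aux b (b + 2 * c) (by rw [formQ]; ring), aux c (2 * b + c) (by rw [formQ]; ring),
    aux (b + c) (b - c) (by rw [formQ]; ring)⟩

theorem coeff_cubicTerm_eq_zero {d n : ℕ} (h : d ≤ n) {p : ℤ × ℤ} (hp : p ∉ hexagon n) :
    PowerSeries.coeff d (cubicTerm p) = 0 := by
  rw [cubicTerm, PowerSeries.coeff_C_mul, PowerSeries.coeff_X_pow, if_neg, mul_zero]
  rintro rfl
  refine hp (mem_hexagon_of_formQ_le ?_)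
  rw [← formQ_toNat]
  exact_mod_cast h

theorem summable_cubicTerm : Summable cubicTerm := by
  rw [PowerSeries.WithPiTopology.summable_iff_summable_coeff]
  exact fun d ↦ summable_of_ne_finset_zero fun p hp ↦ coeff_cubicTerm_eq_zero le_rfl hp

theorem coeff_cubicSeries {d n : ℕ} (h : d ≤ n) :
    PowerSeries.coeff d cubicSeries = PowerSeries.coeff d (∑ p ∈ hexagon n, cubicTerm p) := by
  have h1 := (PowerSeries.WithPiTopology.hasSum_iff_hasSum_coeff _).mp summable_cubicTerm.hasSum d
  rw [map_sum]
  exact h1.unique (hasSum_sum_of_ne_finset_zero fun p hp ↦ coeff_cubicTerm_eq_zero h hp)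

/-! ### Passage to the limit modulo `q ^ N` -/

/-- Reduction of power series modulo `q ^ N`. -/
noncomputable def modXPow (N : ℕ) : ℂ⟦X⟧ →+* ℂ⟦X⟧ ⧸ Ideal.span {(PowerSeries.X : ℂ⟦X⟧) ^ N} :=
  Ideal.Quotient.mk _

theorem modXPow_eq_iff {N : ℕ} {f g : ℂ⟦X⟧} :
    modXPow N f = modXPow N g ↔ PowerSeries.X ^ N ∣ f - g := by
  rw [modXPow, Ideal.Quotient.eq, Ideal.mem_span_singleton]

theorem modXPow_qPochhammer {N m : ℕ} (h : N ≤ m) :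
    modXPow N (qPochhammer PowerSeries.X m) = modXPow N thetaSeries :=
  (modXPow_eq_iff.mpr ((pow_dvd_pow _ (by omega)).trans (X_pow_dvd_thetaSeries_sub m))).symm

theorem modXPow_qPochhammer_cubed {N m : ℕ} (h : N ≤ m) :
    modXPow N (qPochhammer (PowerSeries.X ^ 3) m) = modXPow N thetaSeriesCubed :=
  (modXPow_eq_iff.mpr ((pow_dvd_pow _ (by omega)).trans (X_pow_dvd_thetaSeriesCubed_sub m))).symm

/-- With `a`, `m - a` and `m` all at least `N`, each factor of the factorial formula reduces to
`θ(q)`, and one unit `θ(q)` cancels. -/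
theorem modXPow_gaussBinom {N a m : ℕ} (ha : N ≤ a) (hb : N + a ≤ m) :
    modXPow N (gaussBinom PowerSeries.X m a) * modXPow N thetaSeries = 1 := by
  obtain ⟨b, rfl⟩ := Nat.exists_eq_add_of_le (show a ≤ m by omega)
  have h := congrArg (modXPow N) (gaussBinom_add_mul_qPochhammer (PowerSeries.X : ℂ⟦X⟧) a b)
  rw [map_mul, map_mul, modXPow_qPochhammer ha, modXPow_qPochhammer (by omega),
    modXPow_qPochhammer (by omega)] at h
  exact (isUnit_thetaSeries.map (modXPow N)).mul_right_cancel (h.trans (one_mul _).symm)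

theorem modXPow_gaussBinom_cubed {N n : ℕ} (h : N ≤ n) :
    modXPow N (gaussBinom (PowerSeries.X ^ 3) (2 * n) n) * modXPow N thetaSeriesCubed = 1 := by
  have h := congrArg (modXPow N) (gaussBinom_add_mul_qPochhammer (PowerSeries.X ^ 3 : ℂ⟦X⟧) n n)
  rw [map_mul, map_mul, modXPow_qPochhammer_cubed ‹_›, modXPow_qPochhammer_cubed (by omega),
    ← two_mul] at h
  exact (isUnit_thetaSeriesCubed.map (modXPow N)).mul_right_cancel (h.trans (one_mul _).symm)

theorem modXPow_cubicTerm {N : ℕ} {p : ℤ × ℤ} (h : N ≤ formQ p.1 p.2) :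
    modXPow N (cubicTerm p) = 0 := by
  rw [← map_zero (modXPow N), modXPow_eq_iff, sub_zero, cubicTerm]
  rw [← formQ_toNat] at h
  exact Dvd.dvd.mul_left (pow_dvd_pow _ (by exact_mod_cast h)) _

theorem modXPow_thetaSeries_pow_three (N : ℕ) :
    modXPow N (thetaSeries ^ 3) = modXPow N (cubicSeries * thetaSeriesCubed) := by
  have hG : modXPow N cubicSeries = ∑ p ∈ hexagon (2 * N), modXPow N (cubicTerm p) := by
    rw [← map_sum, modXPow_eq_iff, PowerSeries.X_pow_dvd_iff]
    intro d hd
    rw [map_sub, coeff_cubicSeries (n := 2 * N) (by omega), sub_self]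
  have h := congrArg (modXPow N) (gaussBinom_X_pow_three (2 * N))
  have hS : modXPow N (gaussBinom (PowerSeries.X ^ 3) (2 * (2 * N)) (2 * N)) *
      modXPow N thetaSeries ^ 3 = modXPow N cubicSeries := by
    rw [h, hG, map_sum, Finset.sum_mul]
    refine Finset.sum_congr rfl fun p _ ↦ ?_
    rcases le_or_gt (N : ℤ) (formQ p.1 p.2) with hp | hp
    · rw [map_mul, modXPow_cubicTerm hp, zero_mul, zero_mul]
    -- Here `|b|, |c|, |b + c| ≤ N`, so with `n = 2N` the three lower indices lie in `[N, 3N]`, at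
    -- distance at least `N` from both `0` and `4N`.
    · have hp := mem_hexagon.mp (mem_hexagon_of_formQ_le hp.le)
      have h1 := modXPow_gaussBinom (N := N) (m := 2 * (2 * N))
        (a := ((2 * N : ℕ) - p.1 - p.2).toNat) (by omega) (by omega)
      have h2 := modXPow_gaussBinom (N := N) (m := 2 * (2 * N))
        (a := ((2 * N : ℕ) + p.1).toNat) (by omega) (by omega)
      have h3 := modXPow_gaussBinom (N := N) (m := 2 * (2 * N))
        (a := ((2 * N : ℕ) + p.2).toNat) (by omega) (by omega)
      simp only [map_mul]
      have aux {R : Type _} [CommRing R] {t x y z θ : R} (hx : x * θ = 1) (hy : y * θ = 1)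
          (hz : z * θ = 1) : t * (x * y * z) * θ ^ 3 = t := by
        linear_combination t * (y * θ) * (z * θ) * hx + t * (z * θ) * hy + t * hz
      exact aux h1 h2 h3
  rw [map_mul, ← hS, mul_right_comm, modXPow_gaussBinom_cubed (by omega), one_mul, map_pow]

theorem mainTheorem9 :
    Multipliable eulerFactor ∧
    Summable cubicTerm ∧
    IsUnit thetaSeriesCubed ∧
    thetaSeries ^ 3 * thetaSeriesCubed⁻¹ = cubicSeries := by
  refine ⟨multipliable_eulerFactor, summable_cubicTerm, isUnit_thetaSeriesCubed, ?_⟩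
  have h : thetaSeries ^ 3 = cubicSeries * thetaSeriesCubed := by
    ext d
    have := PowerSeries.X_pow_dvd_iff.mp
      (modXPow_eq_iff.mp (modXPow_thetaSeries_pow_three (d + 1))) d d.lt_succ_self
    rwa [map_sub, sub_eq_zero] at this
  rw [h, mul_assoc, PowerSeries.mul_inv_cancel, mul_one]
  rw [constantCoeff_thetaSeriesCubed]
  exact one_ne_zero
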